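/- Let $n\ge 1$ be an integer and let $0<a_1\le a_2\le\dots\le a_n$ be real numbers. Write $A_n(a)=\frac1n\sum_{k=1}^n a_k$, and for $z\in\mathbb{C}\setminus(-\infty,-a_1]$ let $$G_n(a+z)=\Bigl[\prod_{k=1}^n(a_k+z)\Bigr]^{1/n}:=\exp\Bigl(\frac1n\sum_{k=1}^n\operatorname{Log}(a_k+z)\Bigr),$$ where $\operatorname{Log}$ is the principal logarithm, be the principal branch of the geometric mean of $a_1+z,\dots,a_n+z$. Then for every $z\in\mathbb{C}\setminus(-\infty,-a_1]$ all the integrals below exist and $$G_n(a+z)=A_n(a)+z-\frac1\pi\sum_{\ell=1}^{n-1}\sin\frac{\ell\pi}{n}\int_{a_\ell}^{a_{\ell+1}}\Bigl|\prod_{k=1}^n(a_k-t)\Bigr|^{1/n}\frac{dt}{t+z}.$$ -/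

import Mathlib

/-- The arithmetic mean `A_n(a) = (a_1 + ... + a_n) / n` of the entries `a 1, ..., a n`. -/
noncomputable def arithMean (n : ℕ) (a : ℕ → ℝ) : ℝ :=
  (1 / (n : ℝ)) * ∑ k ∈ Finset.Icc 1 n, a k

/-- The principal branch of the geometric mean
`G_n(w) = (w_1 * ... * w_n) ^ (1/n)` of nonzero complex numbers `w 1, ..., w n`, that is
`exp ((1/n) * (Log w_1 + ... + Log w_n))` with the principal logarithm `Complex.log`.
For `w k = a k + z` this is the holomorphic `n`-th root of the product on the plane cut along
`(-∞, -min a_k]` that is positive for real `z > -min a_k`; it differs in general from the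
principal power of the product, which jumps where the product is a negative real number. -/
noncomputable def geomMeanPrincipal (n : ℕ) (w : ℕ → ℂ) : ℂ :=
  Complex.exp ((1 / (n : ℂ)) * ∑ k ∈ Finset.Icc 1 n, Complex.log (w k))

/-!
The function `F w = ∏ (a k + w) ^ (1 / n)`, formed with principal powers, is holomorphic in the upper
half-plane and continuous up to the real line, because the principal logarithm is continuous from
above on its cut (`continuousOn_geomMeanCpow`). At infinity `F w = w + A + O(1 / w)`, where `A` is the
arithmetic mean of the `a k` (`exists_norm_geomMeanCpow_sub_le`). Hence `g w = F w - w - A` is given in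
the upper half-plane by its boundary values,
`g z = (1 / π) ∫ Im g(x) / (x - z) dx` (`tendsto_integral_im_div_sub`), which follows from Cauchy's
theorem on large rectangles together with the Poisson kernel.

On the real line `Im g = Im F`. At `x = -t` each factor with `a k < t` is negative and contributes the
phase `exp (πi / n)`, so that `Im F (-t) = |∏ (a k - t)| ^ (1 / n) sin (mπ / n)` with `m` the number of
such `k` (`im_geomMeanCpow_neg_ofReal`). This is zero for `t ≤ a 1` and `t > a n`, and `m = ℓ` between
`a ℓ` and `a (ℓ + 1)`, which gives the formula for `Im z > 0`
(`geomMeanPrincipal_eq_of_im_pos`). Conjugation extends it to the lower half-plane, and continuity to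
real `z > -a 1`.
-/

/-! ### Recovering a function on the half-plane from its boundary values -/

open Complex Filter Topology in
/-- Cauchy's theorem for the closed upper half-plane: a function holomorphic in the open half-plane
(off a countable set), continuous up to the real line and `O(|w|⁻²)` at infinity has principal value
integral zero along the real line. The contour is the rectangle `[-R, R] × [0, R]`, whose three
other sides contribute `O(R⁻¹)`. -/
theorem tendsto_intervalIntegral_zero_of_decay {h : ℂ → ℂ} {s : Set ℂ} (hs : s.Countable)
    (hc : ContinuousOn h {w | 0 ≤ w.im}) (hd : ∀ w, 0 < w.im → w ∉ s → DifferentiableAt ℂ h w)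
    {C R₀ : ℝ} (hb : ∀ w : ℂ, 0 ≤ w.im → R₀ ≤ ‖w‖ → ‖h w‖ ≤ C / ‖w‖ ^ 2) :
    Tendsto (fun R : ℝ => ∫ x in (-R)..R, h x) atTop (𝓝 0) := by
  have key : ∀ R : ℝ, max R₀ 1 ≤ R → ‖∫ x in (-R)..R, h x‖ ≤ (4 * |C|) * R⁻¹ := by
    intro R hR
    have hR0 : R₀ ≤ R := (le_max_left _ _).trans hR
    have hR1 : 0 < R := lt_of_lt_of_le one_pos ((le_max_right _ _).trans hR)
    have bound : ∀ w : ℂ, 0 ≤ w.im → R ≤ ‖w‖ → ‖h w‖ ≤ |C| / R ^ 2 := fun w hw hRw =>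
      (hb w hw (hR0.trans hRw)).trans (by
        gcongr
        exact le_abs_self C)
    have H := Complex.integral_boundary_rect_eq_zero_of_differentiable_on_off_countable
      h (-R : ℂ) (R + R * I) s hs
      (hc.mono (fun w hw => by
        have := hw.2
        simp [Set.uIcc_of_le hR1.le] at this
        exact this.1))
      (fun w hw => hd w (by
        have := hw.1.2
        simp [hR1.le] at this
        exact this.1) hw.2)
    simp only [neg_re, ofReal_re, neg_im, ofReal_im, add_re, mul_re, I_re, I_im, mul_zero,
      mul_one, sub_zero, add_zero, add_im, mul_im, zero_add, neg_zero, ofReal_zero, zero_mul,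
      ofReal_neg, smul_eq_mul] at H
    have top : ‖∫ x in (-R)..R, h (x + R * I)‖ ≤ |C| / R ^ 2 * |R - -R| := by
      refine intervalIntegral.norm_integral_le_of_norm_le_const fun x _ =>
        bound _ (by simp [hR1.le]) ?_
      have := Complex.abs_im_le_norm ((x : ℂ) + R * I)
      simp [abs_of_pos hR1] at this
      exact this
    have right : ‖∫ y in (0 : ℝ)..R, h (R + y * I)‖ ≤ |C| / R ^ 2 * |R - 0| := by
      refine intervalIntegral.norm_integral_le_of_norm_le_const fun y hy => bound _ ?_ ?_
      · rw [Set.uIoc_of_le hR1.le] at hy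
        simp [hy.1.le]
      · have := Complex.abs_re_le_norm ((R : ℂ) + y * I)
        simp [abs_of_pos hR1] at this
        exact this
    have left : ‖∫ y in (0 : ℝ)..R, h (-R + y * I)‖ ≤ |C| / R ^ 2 * |R - 0| := by
      refine intervalIntegral.norm_integral_le_of_norm_le_const fun y hy => bound _ ?_ ?_
      · rw [Set.uIoc_of_le hR1.le] at hy
        simp [hy.1.le]
      · have := Complex.abs_re_le_norm (-(R : ℂ) + y * I)
        simp [abs_of_pos hR1] at this
        exact this
    have e : (∫ x in (-R)..R, h x) = (∫ x in (-R)..R, h (x + R * I))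
        - I * (∫ y in (0 : ℝ)..R, h (R + y * I)) + I * ∫ y in (0 : ℝ)..R, h (-R + y * I) := by
      linear_combination H
    rw [e]
    refine (norm_add_le _ _).trans ((add_le_add_left (norm_sub_le _ _) _).trans ?_)
    rw [norm_mul, norm_mul, norm_I, one_mul, one_mul]
    rw [sub_neg_eq_add, abs_of_pos (add_pos hR1 hR1)] at top
    rw [sub_zero, abs_of_pos hR1] at right left
    have : (4 * |C|) * R⁻¹ = |C| / R ^ 2 * (R + R) + |C| / R ^ 2 * R + |C| / R ^ 2 * R := by
      field_simp
      ring
    linarith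
  refine squeeze_zero_norm' ((eventually_ge_atTop _).mono key) ?_
  simpa using tendsto_inv_atTop_zero.const_mul (4 * |C|)

open Complex Filter Topology ComplexConjugate in
/-- The integrand is `1 / (x - z) - 1 / (x - conj z)`, that is `2πi` times the Poisson kernel of the
upper half-plane. -/
theorem tendsto_integral_poisson_kernel {z : ℂ} (hz : 0 < z.im) :
    Tendsto (fun R : ℝ => ∫ x in (-R)..R, (2 * I * z.im / ((x - z) * (x - conj z)) : ℂ)) atTop
      (𝓝 (2 * Real.pi * I)) := by
  have e : ∀ x : ℝ, (2 * I * z.im / ((x - z) * (x - conj z)) : ℂ)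
      = 2 * I * ((z.im⁻¹ * (1 + (z.im⁻¹ * x - z.im⁻¹ * z.re) ^ 2)⁻¹ : ℝ) : ℂ) := by
    intro x
    have h1 : ((x - z) * (x - conj z) : ℂ) = (((x - z.re) ^ 2 + z.im ^ 2 : ℝ) : ℂ) := by
      have h0 : (x - conj z : ℂ) = conj (x - z) := by simp
      rw [h0, mul_conj, normSq_apply]
      simp
      ring
    rw [h1, mul_div_assoc, ← ofReal_div]
    congr 2
    have : 0 < (x - z.re) ^ 2 + z.im ^ 2 := by positivity
    rw [← mul_sub]
    field_simp
    ring_nf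
  have h2 : ∀ R : ℝ, (∫ x in (-R)..R, (2 * I * z.im / ((x - z) * (x - conj z)) : ℂ))
      = 2 * I * ((Real.arctan (z.im⁻¹ * R - z.im⁻¹ * z.re)
          - Real.arctan (z.im⁻¹ * (-R) - z.im⁻¹ * z.re) : ℝ) : ℂ) := by
    intro R
    simp_rw [e]
    rw [intervalIntegral.integral_const_mul, intervalIntegral.integral_ofReal,
      intervalIntegral.integral_const_mul,
      intervalIntegral.integral_comp_mul_sub (fun x => (1 + x ^ 2)⁻¹) (inv_ne_zero hz.ne'),
      integral_inv_one_add_sq, smul_eq_mul, inv_inv, inv_mul_cancel_left₀ hz.ne']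
  simp_rw [h2]
  have hpos : 0 < z.im⁻¹ := inv_pos.2 hz
  have t1 : Tendsto (fun R : ℝ => Real.arctan (z.im⁻¹ * R - z.im⁻¹ * z.re)) atTop
      (𝓝 (Real.pi / 2)) :=
    (Real.tendsto_arctan_atTop.mono_right nhdsWithin_le_nhds).comp
      (tendsto_atTop_add_const_right _ _ (tendsto_id.const_mul_atTop hpos))
  have t2 : Tendsto (fun R : ℝ => Real.arctan (z.im⁻¹ * (-R) - z.im⁻¹ * z.re)) atTop
      (𝓝 (-(Real.pi / 2))) :=
    (Real.tendsto_arctan_atBot.mono_right nhdsWithin_le_nhds).comp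
      (tendsto_atBot_add_const_right _ _ (tendsto_neg_atTop_atBot.const_mul_atBot hpos))
  have t3 := ((continuous_ofReal.tendsto _).comp (t1.sub t2)).const_mul (2 * I)
  have e3 : 2 * I * ((Real.pi / 2 - -(Real.pi / 2) : ℝ) : ℂ) = 2 * Real.pi * I := by
    push_cast
    ring
  rw [e3] at t3
  exact t3

open Complex Filter Topology ComplexConjugate in
/-- A function holomorphic in the upper half-plane, continuous up to the real line and `O(|w|⁻¹)` at
infinity is recovered from the imaginary part of its boundary values. With `2i Im g = g - conj g`, the integral of
`g x / (x - z)` gives `2πi g z`, while that of `conj (g x) / (x - z)` is conjugate to the integral of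
`g x / (x - conj z)`, which vanishes because the pole is outside the half-plane. -/
theorem tendsto_integral_im_div_sub {g : ℂ → ℂ} (hc : ContinuousOn g {w | 0 ≤ w.im})
    (hd : ∀ w, 0 < w.im → DifferentiableAt ℂ g w)
    {C R₀ : ℝ} (hb : ∀ w : ℂ, 0 ≤ w.im → R₀ ≤ ‖w‖ → ‖g w‖ ≤ C / ‖w‖)
    {z : ℂ} (hz : 0 < z.im) :
    Tendsto (fun R : ℝ => ∫ x in (-R)..R, (((g x).im : ℝ) : ℂ) / (x - z)) atTop
      (𝓝 (Real.pi * g z)) := by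
  have ne_conj : ∀ w : ℂ, 0 ≤ w.im → w - conj z ≠ 0 := fun w hw h => by
    have := congrArg im h
    simp at this
    linarith
  have ne_z : ∀ x : ℝ, (x : ℂ) - z ≠ 0 := fun x h => by
    have := congrArg im h
    simp at this
    linarith
  have hC : 0 ≤ |C| := abs_nonneg C
  have sub_bound : ∀ u w : ℂ, ‖u‖ = ‖z‖ → 2 * ‖z‖ ≤ ‖w‖ → ‖w‖ / 2 ≤ ‖w - u‖ := fun u w hu hw => by
    have := norm_sub_norm_le w u
    linarith
  -- The pole at `conj z` lies outside the closed upper half-plane.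
  have lim_conj : Tendsto (fun R : ℝ => ∫ x in (-R)..R, g x / (x - conj z)) atTop (𝓝 0) := by
    refine tendsto_intervalIntegral_zero_of_decay (h := fun w => g w / (w - conj z)) (C := 2 * |C|)
      (R₀ := max (max R₀ 1) (2 * ‖z‖)) Set.countable_empty
      (hc.div (by fun_prop) ne_conj)
      (fun w hw _ => (hd w hw).div (by fun_prop) (ne_conj w hw.le)) fun w hw hR => ?_
    simp only [max_le_iff] at hR
    have h1 := sub_bound (conj z) w (by simp) hR.2
    have h2 := hb w hw hR.1.1
    have h0 : 0 < ‖w‖ := one_pos.trans_le hR.1.2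
    rw [norm_div]
    calc ‖g w‖ / ‖w - conj z‖ ≤ (|C| / ‖w‖) / (‖w‖ / 2) := by
          gcongr
          exact h2.trans (by gcongr; exact le_abs_self C)
      _ = 2 * |C| / ‖w‖ ^ 2 := by field_simp
  -- Subtracting `g z` removes the pole at `z`, and multiplying by the Poisson kernel rather than
  -- by `1 / (w - z)` gives the decay of order two; `dslope g z` is holomorphic off the point `z`.
  have lim_dslope : Tendsto (fun R : ℝ => ∫ x in (-R)..R,
      dslope g z x * (2 * I * z.im / (x - conj z))) atTop (𝓝 0) := by
    refine tendsto_intervalIntegral_zero_of_decay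
      (h := fun w => dslope g z w * (2 * I * z.im / (w - conj z)))
      (C := 8 * (|C| + ‖g z‖) * z.im)
      (R₀ := max (max R₀ 1) (2 * ‖z‖)) (Set.countable_singleton z) ?_ ?_ ?_
    · have hmem : {w : ℂ | 0 ≤ w.im} ∈ 𝓝 z :=
        mem_of_superset ((isOpen_lt continuous_const continuous_im).mem_nhds hz)
          fun w (hw : 0 < w.im) => hw.le
      exact ((continuousOn_dslope hmem).2 ⟨hc, hd z hz⟩).mul
        (continuousOn_const.div (by fun_prop) ne_conj)
    · intro w hw hwz
      exact ((differentiableAt_dslope_of_ne hwz).2 (hd w hw)).mul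
        ((differentiableAt_const _).div (by fun_prop) (ne_conj w hw.le))
    · intro w hw hR
      simp only [max_le_iff] at hR
      have h0 : 0 < ‖w‖ := one_pos.trans_le hR.1.2
      have h1 := sub_bound (conj z) w (by simp) hR.2
      have h1' := sub_bound z w rfl hR.2
      have hne : w ≠ z := by
        rintro rfl
        rw [sub_self, norm_zero] at h1'
        linarith
      have h2 := hb w hw hR.1.1
      have h3 : ‖g w‖ ≤ |C| := by
        refine h2.trans ((div_le_div_of_nonneg_right (le_abs_self C) h0.le).trans ?_)
        exact div_le_self hC hR.1.2
      have h4 : ‖g w - g z‖ ≤ |C| + ‖g z‖ := (norm_sub_le _ _).trans (by linarith)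
      rw [dslope_of_ne _ hne, slope_def_field, norm_mul, norm_div, norm_div]
      have h5 : ‖2 * I * (z.im : ℂ)‖ = 2 * z.im := by simp [abs_of_pos hz]
      rw [h5]
      calc ‖g w - g z‖ / ‖w - z‖ * (2 * z.im / ‖w - conj z‖)
          ≤ (|C| + ‖g z‖) / (‖w‖ / 2) * (2 * z.im / (‖w‖ / 2)) := by gcongr
        _ = 8 * (|C| + ‖g z‖) * z.im / ‖w‖ ^ 2 := by
          field_simp
          ring
  have hgc : Continuous fun x : ℝ => g x := hc.comp_continuous continuous_ofReal (by simp)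
  have c1 : Continuous fun x : ℝ => g x / (x - conj z) :=
    hgc.div (by fun_prop) fun x => ne_conj x (by simp)
  have c2 : Continuous fun x : ℝ => (2 * I * z.im / ((x - z) * (x - conj z)) : ℂ) :=
    continuous_const.div (by fun_prop) fun x => mul_ne_zero (ne_z x) (ne_conj x (by simp))
  have c2' : Continuous fun x : ℝ => g z * (2 * I * z.im / ((x - z) * (x - conj z)) : ℂ) :=
    continuous_const.mul c2
  have c3 : Continuous fun x : ℝ => dslope g z x * (2 * I * z.im / (x - conj z)) := by
    have : (fun x : ℝ => dslope g z x) = fun x : ℝ => (g x - g z) / (x - z) := by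
      funext x
      rw [dslope_of_ne _ (sub_ne_zero.1 (ne_z x)), slope_def_field]
    refine Continuous.mul ?_ (continuous_const.div (by fun_prop) fun x => ne_conj x (by simp))
    rw [this]
    exact (hgc.sub continuous_const).div (by fun_prop) ne_z
  have c4 : Continuous fun x : ℝ => dslope g z x * (2 * I * z.im / (x - conj z)) +
      g z * (2 * I * z.im / ((x - z) * (x - conj z)) : ℂ) := c3.add c2'
  have c5 : Continuous fun x : ℝ => dslope g z x * (2 * I * z.im / (x - conj z)) +
      g z * (2 * I * z.im / ((x - z) * (x - conj z)) : ℂ) + g x / (x - conj z) := c4.add c1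
  have c6 : Continuous fun x : ℝ => conj (g x / (x - conj z)) := continuous_conj.comp c1
  have conj_int : ∀ R : ℝ, conj (∫ x in (-R)..R, g x / (x - conj z))
      = ∫ x in (-R)..R, conj (g x / (x - conj z)) := fun R => by
    rw [intervalIntegral, intervalIntegral, map_sub, ← integral_conj, ← integral_conj]
  have split : ∀ R : ℝ, (∫ x in (-R)..R, (((g x).im : ℝ) : ℂ) / (x - z))
      = (2 * I)⁻¹ * (((∫ x in (-R)..R, dslope g z x * (2 * I * z.im / (x - conj z)))
        + g z * (∫ x in (-R)..R, (2 * I * z.im / ((x - z) * (x - conj z)) : ℂ))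
        + ∫ x in (-R)..R, g x / (x - conj z))
        - conj (∫ x in (-R)..R, g x / (x - conj z))) := fun R => by
    rw [conj_int, ← intervalIntegral.integral_const_mul,
      ← intervalIntegral.integral_add (c3.intervalIntegrable _ _)
        (c2'.intervalIntegrable _ _),
      ← intervalIntegral.integral_add
        (c4.intervalIntegrable _ _) (c1.intervalIntegrable _ _),
      ← intervalIntegral.integral_sub
        (c5.intervalIntegrable _ _)
        (c6.intervalIntegrable _ _),
      ← intervalIntegral.integral_const_mul]
    refine intervalIntegral.integral_congr fun x _ => ?_
    have hz1 := ne_z x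
    have hz2 := ne_conj x (by simp)
    have hk : (2 * I * z.im : ℂ) = (x - conj z) - (x - z) := by
      have := Complex.sub_conj z
      push_cast at this
      linear_combination -this
    have hi : ((g x).im : ℂ) = (2 * I)⁻¹ * (g x - conj (g x)) := by
      rw [Complex.sub_conj]
      push_cast
      field_simp
    simp only [dslope_of_ne _ (sub_ne_zero.1 hz1), slope_def_field, map_div₀, map_sub, conj_conj,
      conj_ofReal]
    rw [hk, hi]
    field_simp
    ring
  have lim := ((((lim_dslope.add ((tendsto_integral_poisson_kernel hz).const_mul (g z))).add
    lim_conj).sub ((continuous_conj.tendsto _).comp lim_conj)).const_mul (2 * I)⁻¹)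
  have e : (2 * I)⁻¹ * (0 + g z * (2 * Real.pi * I) + 0 - conj (0 : ℂ)) = Real.pi * g z := by
    rw [map_zero]
    field_simp
    ring
  rw [e] at lim
  simp_rw [split]
  exact lim

/-! ### The geometric mean on the closed upper half-plane -/

/-- The geometric mean of `a 1 + w, ..., a n + w` as a product of principal powers. It agrees with
`geomMeanPrincipal` where no factor vanishes; at a zero of a factor it takes the value `0`, whereas
`exp (log 0 / n) = 1`, so that this version is continuous on the whole closed upper half-plane. -/
noncomputable def geomMeanCpow (n : ℕ) (a : ℕ → ℝ) (w : ℂ) : ℂ :=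
  ∏ k ∈ Finset.Icc 1 n, ((a k : ℂ) + w) ^ (1 / (n : ℂ))

/-- On the cut itself this holds because the principal logarithm is continuous from above there. -/
theorem continuousOn_cpow_const_upperHalfPlane {c : ℂ} (hc : 0 < c.re) :
    ContinuousOn (fun w : ℂ => w ^ c) {w | 0 ≤ w.im} := by
  have hc0 : c ≠ 0 := by
    rintro rfl
    simp at hc
  intro w hw
  by_cases h : 0 ≤ w.re ∨ w.im ≠ 0
  · exact (Complex.continuousAt_cpow_const_of_re_pos h hc).continuousWithinAt
  · push Not at h
    have hw0 : w ≠ 0 := by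
      rintro rfl
      simp at h
    have hlog := Complex.continuousWithinAt_log_of_re_neg_of_im_zero h.1 h.2
    have hexp : ContinuousWithinAt (fun v => Complex.exp (Complex.log v * c)) {w | 0 ≤ w.im} w :=
      Complex.continuous_exp.continuousAt.comp_continuousWithinAt
        (hlog.mul continuousWithinAt_const)
    refine hexp.congr_of_eventuallyEq ?_ (Complex.cpow_def_of_ne_zero hw0 _)
    filter_upwards [nhdsWithin_le_nhds (isOpen_ne.mem_nhds hw0)] with v hv
    exact Complex.cpow_def_of_ne_zero hv _

theorem re_one_div_natCast_pos {n : ℕ} (hn : 1 ≤ n) : 0 < (1 / (n : ℂ)).re := by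
  have h : (1 / (n : ℂ)) = ((1 / (n : ℝ) : ℝ) : ℂ) := by push_cast; rfl
  rw [h, Complex.ofReal_re]
  have : (0 : ℝ) < n := by exact_mod_cast hn
  positivity

theorem continuousOn_geomMeanCpow {n : ℕ} (hn : 1 ≤ n) (a : ℕ → ℝ) :
    ContinuousOn (geomMeanCpow n a) {w | 0 ≤ w.im} :=
  continuousOn_finsetProd _ fun k _ =>
    (continuousOn_cpow_const_upperHalfPlane (re_one_div_natCast_pos hn)).comp (by fun_prop)
      fun w hw => by simpa using hw

theorem differentiableAt_geomMeanCpow (n : ℕ) (a : ℕ → ℝ) {w : ℂ} (hw : 0 < w.im) :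
    DifferentiableAt ℂ (geomMeanCpow n a) w := by
  unfold geomMeanCpow
  refine DifferentiableAt.fun_finsetProd fun k _ => ?_
  refine DifferentiableAt.cpow (by fun_prop) (by fun_prop) (Or.inr ?_)
  simpa using hw.ne'

theorem geomMeanCpow_eq_geomMeanPrincipal {n : ℕ} {a : ℕ → ℝ} {w : ℂ}
    (h : ∀ k ∈ Finset.Icc 1 n, (a k : ℂ) + w ≠ 0) :
    geomMeanCpow n a w = geomMeanPrincipal n fun k => (a k : ℂ) + w := by
  rw [geomMeanCpow, geomMeanPrincipal, Finset.mul_sum, Complex.exp_sum]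
  refine Finset.prod_congr rfl fun k hk => ?_
  rw [Complex.cpow_def_of_ne_zero (h k hk), mul_comm]

/-! ### Boundary values on the cut -/

theorem ofReal_cpow_one_div_natCast (n : ℕ) (x : ℝ) :
    (x : ℂ) ^ (1 / (n : ℂ)) =
      ((|x| ^ (1 / (n : ℝ)) : ℝ) : ℂ) *
        Complex.exp (if x < 0 then Real.pi / n * Complex.I else 0) := by
  split_ifs with hx
  · rw [Complex.ofReal_cpow_of_nonpos hx.le, Complex.ofReal_cpow (abs_nonneg x), abs_of_neg hx]
    push_cast
    congr 2
    ring
  · push Not at hx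
    rw [Complex.ofReal_cpow (abs_nonneg x), abs_of_nonneg hx]
    simp

/-- Boundary values on the cut: each negative factor `a k - t` contributes the phase `exp (πi / n)`.
A zero factor contributes no phase, so the formula holds at `t = a k` as well. -/
theorem geomMeanCpow_neg_ofReal (n : ℕ) (a : ℕ → ℝ) (t : ℝ) :
    geomMeanCpow n a (-t : ℂ) =
      ((|∏ k ∈ Finset.Icc 1 n, (a k - t)| ^ (1 / (n : ℝ)) : ℝ) : ℂ) *
        Complex.exp (((((Finset.Icc 1 n).filter fun k => a k < t).card * Real.pi / n : ℝ) : ℂ) *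
          Complex.I) := by
  have h : ∀ k, ((a k : ℂ) + -t) ^ (1 / (n : ℂ)) = _ := fun k => by
    rw [← sub_eq_add_neg, ← Complex.ofReal_sub, ofReal_cpow_one_div_natCast]
  rw [geomMeanCpow, Finset.prod_congr rfl fun k _ => h k, Finset.prod_mul_distrib,
    ← Complex.exp_sum, ← Complex.ofReal_prod, Finset.abs_prod,
    Real.finsetProd_rpow _ _ fun _ _ => abs_nonneg _]
  congr 2
  simp only [sub_neg, ← Finset.sum_filter, Finset.sum_const, nsmul_eq_mul]
  push_cast
  ring

theorem im_geomMeanCpow_neg_ofReal (n : ℕ) (a : ℕ → ℝ) (t : ℝ) :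
    (geomMeanCpow n a (-t : ℂ)).im =
      |∏ k ∈ Finset.Icc 1 n, (a k - t)| ^ (1 / (n : ℝ)) *
        Real.sin (((Finset.Icc 1 n).filter fun k => a k < t).card * Real.pi / n) := by
  rw [geomMeanCpow_neg_ofReal, Complex.im_ofReal_mul, Complex.exp_ofReal_mul_I_im]

/-! ### Expansion at infinity -/

/-- No multiple of `2πi` appears, since `0 ≤ arg w ≤ π` and `-π / 2 < arg (1 + a / w) ≤ 0`. -/
theorem Complex.log_ofReal_add_of_im_nonneg {a : ℝ} (ha : 0 < a) {w : ℂ} (hw : 0 ≤ w.im)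
    (haw : a < ‖w‖) :
    Complex.log (a + w) = Complex.log w + Complex.log (1 + a * w⁻¹) := by
  have hw0 : w ≠ 0 := norm_pos_iff.1 (ha.trans haw)
  have hlt : ‖(a : ℂ) * w⁻¹‖ < 1 := by
    rw [norm_mul, norm_inv, Complex.norm_real, Real.norm_of_nonneg ha.le, ← div_eq_mul_inv]
    exact (div_lt_one (ha.trans haw)).2 haw
  have hre : 0 < (1 + (a : ℂ) * w⁻¹).re := by
    have := (abs_le.1 (Complex.abs_re_le_norm ((a : ℂ) * w⁻¹))).1
    rw [Complex.add_re, Complex.one_re]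
    linarith
  have him : (1 + (a : ℂ) * w⁻¹).im ≤ 0 := by
    rw [Complex.add_im, Complex.one_im, Complex.im_ofReal_mul, Complex.inv_im, zero_add]
    refine mul_nonpos_of_nonneg_of_nonpos ha.le (div_nonpos_of_nonpos_of_nonneg (by linarith) ?_)
    exact Complex.normSq_nonneg w
  have h1 : (a : ℂ) + w = w * (1 + a * w⁻¹) := by
    field_simp
    ring
  have harg := abs_lt.1 (Complex.abs_arg_lt_pi_div_two_iff.2 (Or.inl hre))
  have harg' : (1 + (a : ℂ) * w⁻¹).arg ≤ 0 := by
    rcases him.lt_or_eq with h | h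
    · exact (Complex.arg_neg_iff.2 h).le
    · exact (Complex.arg_eq_zero_iff.2 ⟨hre.le, h⟩).le
  have hargw := Complex.arg_nonneg_iff.2 hw
  rw [h1, Complex.log_mul hw0 (fun h => by simp [h] at hre)]
  constructor
  · linarith [Real.pi_pos]
  · linarith [Complex.arg_le_pi w]

theorem geomMeanCpow_eq_mul_exp {n : ℕ} (hn : 1 ≤ n) {a : ℕ → ℝ}
    (ha : ∀ k ∈ Finset.Icc 1 n, 0 < a k) {w : ℂ} (hw : 0 ≤ w.im)
    (haw : ∀ k ∈ Finset.Icc 1 n, a k < ‖w‖) :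
    geomMeanCpow n a w =
      w * Complex.exp ((1 / (n : ℂ)) * ∑ k ∈ Finset.Icc 1 n, Complex.log (1 + a k * w⁻¹)) := by
  have hw0 : w ≠ 0 := by
    have h1 : 1 ∈ Finset.Icc 1 n := Finset.mem_Icc.2 ⟨le_rfl, hn⟩
    exact norm_pos_iff.1 ((ha 1 h1).trans (haw 1 h1))
  have hn0 : (n : ℂ) ≠ 0 := by exact_mod_cast (by omega : n ≠ 0)
  have hne : ∀ k ∈ Finset.Icc 1 n, (a k : ℂ) + w ≠ 0 := fun k hk h => by
    have h2 := haw k hk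
    rw [← neg_eq_of_add_eq_zero_right h, norm_neg, Complex.norm_real,
      Real.norm_of_nonneg (ha k hk).le] at h2
    exact lt_irrefl _ h2
  rw [geomMeanCpow_eq_geomMeanPrincipal hne, geomMeanPrincipal,
    Finset.sum_congr rfl fun k hk =>
      Complex.log_ofReal_add_of_im_nonneg (ha k hk) hw (haw k hk),
    Finset.sum_add_distrib, Finset.sum_const, Nat.card_Icc, Nat.add_sub_cancel, nsmul_eq_mul,
    mul_add, ← mul_assoc, one_div_mul_cancel hn0, one_mul, Complex.exp_add, Complex.exp_log hw0]

open Asymptotics Topology in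
/-- Taylor expansion at `s = 0`, used with `s = 1 / w`; the linear coefficient is the arithmetic
mean. -/
theorem exp_mean_log_isBigO (n : ℕ) (a : ℕ → ℝ) :
    (fun s : ℂ => Complex.exp ((1 / (n : ℂ)) * ∑ k ∈ Finset.Icc 1 n, Complex.log (1 + a k * s))
        - 1 - arithMean n a * s) =O[𝓝 0] fun s => ‖s‖ ^ 2 := by
  set E : ℂ → ℂ := fun s =>
    Complex.exp ((1 / (n : ℂ)) * ∑ k ∈ Finset.Icc 1 n, Complex.log (1 + a k * s)) with hE
  have hlog : ∀ k : ℕ, AnalyticAt ℂ (fun s : ℂ => Complex.log (1 + a k * s)) 0 := fun k =>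
    (by fun_prop : AnalyticAt ℂ (fun s : ℂ => 1 + a k * s) 0).clog (by simp)
  have hE_an : AnalyticAt ℂ E 0 :=
    (analyticAt_const.mul (Finset.analyticAt_fun_sum _ fun k _ => hlog k)).cexp
  have hE0 : E 0 = 1 := by simp [hE]
  have hderiv : HasDerivAt E (arithMean n a : ℂ) 0 := by
    have h1 : ∀ k : ℕ, HasDerivAt (fun s : ℂ => Complex.log (1 + a k * s)) (a k : ℂ) 0 := fun k => by
      have h := (((hasDerivAt_id (0 : ℂ)).const_mul (a k : ℂ)).const_add 1).clog (by simp)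
      simpa using h
    have h2 := ((HasDerivAt.fun_sum (u := Finset.Icc 1 n) fun k _ => h1 k).const_mul
      (1 / (n : ℂ))).cexp
    have e : (arithMean n a : ℂ) = 1 / (n : ℂ) * ∑ k ∈ Finset.Icc 1 n, (a k : ℂ) := by
      simp [arithMean]
    rw [e]
    simpa [hE] using h2
  obtain ⟨p, hp⟩ := hE_an
  have hO := hp.isBigO_sub_partialSum_pow 2
  refine hO.congr_left fun s => ?_
  have hp0 : p.coeff 0 = 1 := by rw [← hE0]; exact hp.coeff_zero _
  have hp1 : p.coeff 1 = arithMean n a := hp.hasDerivAt.unique hderiv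
  simp only [FormalMultilinearSeries.partialSum, Finset.sum_range_succ, Finset.range_zero,
    Finset.sum_empty, FormalMultilinearSeries.apply_eq_pow_smul_coeff, hp0, hp1]
  simp [hE]
  ring

open Filter Topology in
/-- The geometric mean of the `a k + w` is `w + A + O(1 / w)` in the closed upper half-plane, with
`A` the arithmetic mean of the `a k`. -/
theorem exists_norm_geomMeanCpow_sub_le {n : ℕ} (hn : 1 ≤ n) {a : ℕ → ℝ}
    (ha : ∀ k ∈ Finset.Icc 1 n, 0 < a k) :
    ∃ C R : ℝ, ∀ w : ℂ, 0 ≤ w.im → R ≤ ‖w‖ →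
      ‖geomMeanCpow n a w - w - arithMean n a‖ ≤ C / ‖w‖ := by
  obtain ⟨C, hC⟩ := (exp_mean_log_isBigO n a).bound
  obtain ⟨R₁, hR₁⟩ := (hasBasis_cobounded_norm.eventually_iff).1
    ((tendsto_inv₀_cobounded (α := ℂ)).eventually hC)
  refine ⟨C, max (max R₁ 1) (∑ k ∈ Finset.Icc 1 n, a k + 1), fun w hw hR => ?_⟩
  simp only [max_le_iff] at hR
  have hw0 : w ≠ 0 := norm_pos_iff.1 (one_pos.trans_le hR.1.2)
  have h1 := hR₁.2 hR.1.1
  have hak : ∀ k ∈ Finset.Icc 1 n, a k < ‖w‖ := fun k hk => by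
    have := Finset.single_le_sum (fun i hi => (ha i hi).le) hk
    linarith [hR.2]
  rw [geomMeanCpow_eq_mul_exp hn ha hw hak]
  have e : ∀ x : ℂ, w * x - w - arithMean n a = w * (x - 1 - arithMean n a * w⁻¹) := fun x => by
    field_simp
  rw [e, norm_mul]
  calc _ ≤ ‖w‖ * (C * ‖‖w⁻¹‖ ^ 2‖) := by gcongr
    _ = C / ‖w‖ := by
      have : ‖w‖ ≠ 0 := norm_ne_zero_iff.2 hw0
      rw [norm_pow, norm_norm, norm_inv]
      field_simp

/-! ### Integrals along the cut -/

theorem intervalIntegrable_rpow_div_add {P : ℝ → ℝ} (hP : Continuous P) {r : ℝ} (hr : 0 ≤ r) {z : ℂ}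
    {b c : ℝ} (hz : ∀ t ∈ Set.uIcc b c, (t : ℂ) + z ≠ 0) :
    IntervalIntegrable (fun t : ℝ => ((|P t| ^ r : ℝ) : ℂ) / ((t : ℂ) + z))
      MeasureTheory.volume b c := by
  have h1 : Continuous fun t : ℝ => |P t| ^ r := hP.abs.rpow_const fun _ => Or.inr hr
  exact ((Complex.continuous_ofReal.comp h1).continuousOn.div (by fun_prop) hz).intervalIntegrable

theorem card_filter_lt {n ℓ : ℕ} (hℓ : ℓ ≤ n) {a : ℕ → ℝ} {t : ℝ}
    (h1 : ∀ k, 1 ≤ k → k ≤ ℓ → a k < t) (h2 : ∀ k, ℓ < k → k ≤ n → t ≤ a k) :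
    ((Finset.Icc 1 n).filter fun k => a k < t).card = ℓ := by
  have : ((Finset.Icc 1 n).filter fun k => a k < t) = Finset.Icc 1 ℓ := by
    ext k
    simp only [Finset.mem_filter, Finset.mem_Icc]
    constructor
    · rintro ⟨⟨hk1, hkn⟩, hk⟩
      refine ⟨hk1, ?_⟩
      by_contra! hlt
      exact absurd hk (not_lt.2 (h2 k hlt hkn))
    · rintro ⟨hk1, hkl⟩
      exact ⟨⟨hk1, hkl.trans hℓ⟩, h1 k hk1 hkl⟩
  rw [this, Nat.card_Icc, Nat.add_sub_cancel]

/-- The imaginary part on the real line vanishes outside `[-a n, -a 1]`, where the phase is `0` or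
`π`, and on `(-a (ℓ + 1), -a ℓ)` the phase is `ℓπ / n`. The substitution `x = -t` produces the sign. -/
theorem integral_im_geomMeanCpow_div {n : ℕ} (hn : 1 ≤ n) {a : ℕ → ℝ}
    (ha : ∀ i j, 1 ≤ i → i ≤ j → j ≤ n → a i ≤ a j) {z : ℂ} (hz : 0 < z.im) {R : ℝ}
    (h1 : -R ≤ a 1) (hR : a n ≤ R) :
    ∫ x in (-R)..R, (((geomMeanCpow n a x).im : ℝ) : ℂ) / (x - z) =
      -∑ ℓ ∈ Finset.Ico 1 n,
        ((Real.sin ((ℓ : ℝ) * Real.pi / (n : ℝ)) : ℝ) : ℂ) *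
          ∫ t in (a ℓ)..(a (ℓ + 1)),
            ((|∏ k ∈ Finset.Icc 1 n, (a k - t)| ^ (1 / (n : ℝ)) : ℝ) : ℂ) / ((t : ℂ) + z) := by
  set φ : ℝ → ℂ := fun t => (((geomMeanCpow n a (-t : ℂ)).im : ℝ) : ℂ) / (t + z) with hφ
  have hne : ∀ t : ℝ, (t : ℂ) + z ≠ 0 := fun t h => by
    have := congrArg Complex.im h
    simp at this
    linarith
  have hφc : Continuous φ := by
    refine Continuous.div ?_ (by fun_prop) hne
    exact Complex.continuous_ofReal.comp (Complex.continuous_im.comp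
      ((continuousOn_geomMeanCpow hn a).comp_continuous (by fun_prop) (by simp)))
  have hint : ∀ b c, IntervalIntegrable φ MeasureTheory.volume b c :=
    fun b c => hφc.intervalIntegrable b c
  have hsub : ∫ x in (-R)..R, (((geomMeanCpow n a x).im : ℝ) : ℂ) / (x - z)
      = -∫ t in (-R)..R, φ t := by
    have := intervalIntegral.integral_comp_neg (a := -R) (b := R)
      fun x : ℝ => (((geomMeanCpow n a x).im : ℝ) : ℂ) / (x - z)
    rw [neg_neg] at this
    rw [← this, ← intervalIntegral.integral_neg]
    refine intervalIntegral.integral_congr fun t _ => ?_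
    simp only [hφ, Complex.ofReal_neg]
    rw [← div_neg, neg_add, sub_eq_add_neg]
  -- The intervals are half-open on the left because the count of negative factors uses `a k < t`.
  have hpiece : ∀ ℓ ≤ n, ∀ b c : ℝ, b ≤ c →
      (∀ t ∈ Set.Ioc b c, (∀ k, 1 ≤ k → k ≤ ℓ → a k < t) ∧ ∀ k, ℓ < k → k ≤ n → t ≤ a k) →
      ∫ t in b..c, φ t = ((Real.sin ((ℓ : ℝ) * Real.pi / (n : ℝ)) : ℝ) : ℂ) *
          ∫ t in b..c,
            ((|∏ k ∈ Finset.Icc 1 n, (a k - t)| ^ (1 / (n : ℝ)) : ℝ) : ℂ) / ((t : ℂ) + z) := by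
    intro ℓ hℓ b c hbc h
    rw [← intervalIntegral.integral_const_mul, intervalIntegral.integral_of_le hbc,
      intervalIntegral.integral_of_le hbc]
    refine MeasureTheory.setIntegral_congr_fun measurableSet_Ioc fun t ht => ?_
    simp only [hφ]
    rw [im_geomMeanCpow_neg_ofReal, card_filter_lt hℓ (h t ht).1 (h t ht).2]
    push_cast
    ring
  have hleft : ∫ t in (-R)..(a 1), φ t = 0 := by
    rw [hpiece 0 (Nat.zero_le _) _ _ h1 fun t ht =>
      ⟨fun k hk hk0 => by omega, fun k hk hkn => ht.2.trans (ha 1 k le_rfl hk hkn)⟩]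
    simp
  have hright : ∫ t in (a n)..R, φ t = 0 := by
    have hn0 : (n : ℝ) ≠ 0 := by exact_mod_cast (by omega : n ≠ 0)
    rw [hpiece n le_rfl _ _ hR fun t ht =>
      ⟨fun k hk hkn => (ha k n hk hkn le_rfl).trans_lt ht.1, fun k hk hkn => by omega⟩,
      mul_div_cancel_left₀ _ hn0]
    simp
  rw [hsub, ← intervalIntegral.integral_add_adjacent_intervals (hint _ (a 1)) (hint _ _), hleft,
    ← intervalIntegral.integral_add_adjacent_intervals (hint _ (a n)) (hint _ _), hright,
    zero_add, add_zero,
    ← intervalIntegral.sum_integral_adjacent_intervals_Ico hn fun k _ => hint _ _]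
  congr 1
  refine Finset.sum_congr rfl fun ℓ hℓ => ?_
  rw [Finset.mem_Ico] at hℓ
  exact hpiece ℓ hℓ.2.le _ _ (ha _ _ hℓ.1 (Nat.le_succ _) hℓ.2) fun t ht =>
    ⟨fun k hk hkl => (ha k ℓ hk hkl hℓ.2.le).trans_lt ht.1,
      fun k hk hkn => ht.2.trans (ha _ k (by omega) hk hkn)⟩

/-! ### The formula in the upper half-plane -/

/-- The expression `A_n(a) + z - (1 / π) ∑ sin (ℓπ / n) ∫ |∏ (a_k - t)| ^ (1 / n) / (t + z) dt`, to be
identified with the geometric mean of the `a k + z`. -/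
noncomputable def geomMeanIntegral (n : ℕ) (a : ℕ → ℝ) (z : ℂ) : ℂ :=
  (arithMean n a : ℂ) + z
    - (1 / (Real.pi : ℂ)) *
      ∑ ℓ ∈ Finset.Ico 1 n,
        ((Real.sin ((ℓ : ℝ) * Real.pi / (n : ℝ)) : ℝ) : ℂ) *
          ∫ t in (a ℓ)..(a (ℓ + 1)),
            ((|∏ k ∈ Finset.Icc 1 n, (a k - t)| ^ (1 / (n : ℝ)) : ℝ) : ℂ) / ((t : ℂ) + z)

open Filter in
theorem geomMeanPrincipal_eq_of_im_pos {n : ℕ} (hn : 1 ≤ n) {a : ℕ → ℝ} (ha_pos : 0 < a 1)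
    (ha : ∀ i j, 1 ≤ i → i ≤ j → j ≤ n → a i ≤ a j) {z : ℂ} (hz : 0 < z.im) :
    geomMeanPrincipal n (fun k => (a k : ℂ) + z) = geomMeanIntegral n a z := by
  have hpos : ∀ k ∈ Finset.Icc 1 n, 0 < a k := fun k hk => by
    rw [Finset.mem_Icc] at hk
    exact ha_pos.trans_le (ha 1 k le_rfl hk.1 hk.2)
  obtain ⟨C, R₀, hb⟩ := exists_norm_geomMeanCpow_sub_le hn hpos
  have lim := tendsto_integral_im_div_sub
    (g := fun w => geomMeanCpow n a w - w - arithMean n a)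
    (((continuousOn_geomMeanCpow hn a).sub continuousOn_id).sub continuousOn_const)
    (fun w hw => ((differentiableAt_geomMeanCpow n a hw).sub differentiableAt_id).sub
      (differentiableAt_const _)) hb hz
  simp only [Complex.sub_im, Complex.ofReal_im, sub_zero] at lim
  -- The truncated integrals do not depend on `R` once `[-R, R]` contains `[-a n, -a 1]`.
  have hconst := (tendsto_const_nhds.congr' ((eventually_ge_atTop (max (-a 1) (a n))).mono
    fun R hR => (integral_im_geomMeanCpow_div hn ha hz (by linarith [le_max_left (-a 1) (a n)])
      ((le_max_right _ _).trans hR)).symm))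
  have key := tendsto_nhds_unique lim hconst
  have hpi : (Real.pi : ℂ) ≠ 0 := by exact_mod_cast Real.pi_ne_zero
  rw [← geomMeanCpow_eq_geomMeanPrincipal fun k _ h => by
    have := congrArg Complex.im h
    simp at this
    exact hz.ne' this, geomMeanIntegral]
  linear_combination (1 / (Real.pi : ℂ)) * key -
    (geomMeanCpow n a z - z - arithMean n a) * mul_one_div_cancel hpi

/-! ### Extension to the slit plane -/

open ComplexConjugate in
theorem geomMeanPrincipal_conj (n : ℕ) {w : ℕ → ℂ}
    (hw : ∀ k ∈ Finset.Icc 1 n, (w k).arg ≠ Real.pi) :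
    geomMeanPrincipal n (fun k => conj (w k)) = conj (geomMeanPrincipal n w) := by
  rw [geomMeanPrincipal, geomMeanPrincipal, ← Complex.exp_conj, map_mul, map_sum,
    Finset.sum_congr rfl fun k hk => Complex.log_conj _ (hw k hk)]
  simp

open ComplexConjugate in
theorem geomMeanIntegral_conj (n : ℕ) (a : ℕ → ℝ) (z : ℂ) :
    geomMeanIntegral n a (conj z) = conj (geomMeanIntegral n a z) := by
  simp only [geomMeanIntegral, map_sub, map_add, map_mul, map_sum, map_div₀, map_one,
    Complex.conj_ofReal]
  congr 2
  refine Finset.sum_congr rfl fun ℓ _ => ?_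
  congr 1
  rw [intervalIntegral, intervalIntegral, map_sub, ← integral_conj, ← integral_conj]
  simp

open Complex Filter Topology in
theorem continuousAt_geomMeanIntegral_add_mul_I {n : ℕ} {a : ℕ → ℝ}
    (ha : ∀ i j, 1 ≤ i → i ≤ j → j ≤ n → a i ≤ a j) {x : ℝ} (hx : -a 1 < x) :
    ContinuousAt (fun ε : ℝ => geomMeanIntegral n a (x + ε * I)) 0 := by
  unfold geomMeanIntegral
  refine ContinuousAt.sub (by fun_prop) (continuousAt_const.mul ?_)
  refine tendsto_finsetSum _ fun ℓ hℓ => ?_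
  rw [Finset.mem_Ico] at hℓ
  have hle : a ℓ ≤ a (ℓ + 1) := ha _ _ hℓ.1 (Nat.le_succ _) hℓ.2
  have htx : ∀ t ∈ Set.Icc (a ℓ) (a (ℓ + 1)), 0 < t + x := fun t ht => by
    have := ha 1 ℓ le_rfl hℓ.1 hℓ.2.le
    linarith [ht.1]
  have hre : ∀ t ε : ℝ, ((t : ℂ) + (x + ε * I)).re = t + x := fun t ε => by simp
  have hne : ∀ ε : ℝ, ∀ t ∈ Set.Icc (a ℓ) (a (ℓ + 1)), (t : ℂ) + (x + ε * I) ≠ 0 :=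
    fun ε t ht h => by
      have := htx t ht
      rw [← hre t ε, h] at this
      exact lt_irrefl _ this
  have hint : ∀ ε : ℝ, IntervalIntegrable
      (fun t : ℝ => ((|∏ k ∈ Finset.Icc 1 n, (a k - t)| ^ (1 / (n : ℝ)) : ℝ) : ℂ) /
        ((t : ℂ) + (x + ε * I))) MeasureTheory.volume (a ℓ) (a (ℓ + 1)) := fun ε =>
    intervalIntegrable_rpow_div_add (P := fun t => ∏ k ∈ Finset.Icc 1 n, (a k - t))
      (by fun_prop) (by positivity) (by rw [Set.uIcc_of_le hle]; exact hne ε)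
  refine continuousAt_const.mul (intervalIntegral.continuousAt_of_dominated_interval
    (bound := fun t => ‖((|∏ k ∈ Finset.Icc 1 n, (a k - t)| ^ (1 / (n : ℝ)) : ℝ) : ℂ) /
        ((t : ℂ) + (x + (0 : ℝ) * I))‖) (Eventually.of_forall fun ε => ?_)
    (Eventually.of_forall fun ε => Eventually.of_forall fun t ht => ?_) (hint 0).norm
    (Eventually.of_forall fun t ht => ?_))
  · rw [Set.uIoc_of_le hle]
    exact (hint ε).1.aestronglyMeasurable
  · rw [Set.uIoc_of_le hle] at ht
    have htx' := htx t ⟨ht.1.le, ht.2⟩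
    have h0 : ‖(t : ℂ) + (x + (0 : ℝ) * I)‖ = t + x := by
      rw [ofReal_zero, zero_mul, add_zero, ← ofReal_add, norm_real, Real.norm_of_nonneg htx'.le]
    rw [norm_div, norm_div, h0]
    gcongr
    rw [← hre t ε]
    exact re_le_norm _
  · rw [Set.uIoc_of_le hle] at ht
    exact continuousAt_const.div (by fun_prop) (hne 0 t ⟨ht.1.le, ht.2⟩)

open Complex Filter Topology in
theorem continuousAt_geomMeanPrincipal_add_mul_I {n : ℕ} {a : ℕ → ℝ}
    (ha : ∀ i j, 1 ≤ i → i ≤ j → j ≤ n → a i ≤ a j) {x : ℝ} (hx : -a 1 < x) :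
    ContinuousAt (fun ε : ℝ => geomMeanPrincipal n fun k => (a k : ℂ) + (x + ε * I)) 0 := by
  unfold geomMeanPrincipal
  refine continuous_exp.continuousAt.comp (continuousAt_const.mul
    (tendsto_finsetSum _ fun k hk => ?_))
  rw [Finset.mem_Icc] at hk
  have : ContinuousAt (fun ε : ℝ => (a k : ℂ) + (x + ε * I)) 0 := by fun_prop
  refine this.clog (Or.inl ?_)
  have := ha 1 k le_rfl hk.1 hk.2
  simp
  linarith

open Complex Filter Topology ComplexConjugate in
theorem geomMeanPrincipal_eq_geomMeanIntegral {n : ℕ} (hn : 1 ≤ n) {a : ℕ → ℝ} (ha_pos : 0 < a 1)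
    (ha : ∀ i j, 1 ≤ i → i ≤ j → j ≤ n → a i ≤ a j) {z : ℂ}
    (hz : z ∉ Complex.ofReal '' Set.Iic (-a 1)) :
    geomMeanPrincipal n (fun k => (a k : ℂ) + z) = geomMeanIntegral n a z := by
  rcases lt_trichotomy z.im 0 with h | h | h
  -- Below the real axis, both sides are conjugate to their values at `conj z`.
  · have hc : 0 < (conj z).im := by simpa using h
    have h1 := geomMeanPrincipal_eq_of_im_pos hn ha_pos ha hc
    have h2 := geomMeanPrincipal_conj n (w := fun k => (a k : ℂ) + conj z) fun k _ harg => by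
      have := (arg_eq_pi_iff.1 harg).2
      simp at this
      exact h.ne this
    rw [h1, ← geomMeanIntegral_conj] at h2
    simpa using h2
  -- On the real axis, both sides are limits from the upper half-plane.
  · obtain ⟨x, rfl⟩ : ∃ x : ℝ, (x : ℂ) = z := ⟨z.re, Complex.ext (by simp) (by simp [h])⟩
    have hx : -a 1 < x := by
      by_contra! hle
      exact hz ⟨x, hle, rfl⟩
    have t1 := (continuousAt_geomMeanPrincipal_add_mul_I ha hx).tendsto.mono_left
      (nhdsWithin_le_nhds (s := Set.Ioi (0 : ℝ)))
    have t2 := (continuousAt_geomMeanIntegral_add_mul_I ha hx).tendsto.mono_left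
      (nhdsWithin_le_nhds (s := Set.Ioi (0 : ℝ)))
    have t3 := t1.congr' ((eventually_mem_nhdsWithin (s := Set.Ioi (0 : ℝ))).mono fun ε (hε : 0 < ε) =>
      geomMeanPrincipal_eq_of_im_pos hn ha_pos ha (by simpa using hε))
    simpa using tendsto_nhds_unique t3 t2
  · exact geomMeanPrincipal_eq_of_im_pos hn ha_pos ha h

theorem theorem1 (n : ℕ) (hn : 1 ≤ n) (a : ℕ → ℝ)
    (ha_pos : 0 < a 1)
    (ha_mono : ∀ k : ℕ, 1 ≤ k → k < n → a k ≤ a (k + 1))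
    (z : ℂ) (hz : z ∉ Complex.ofReal '' Set.Iic (-a 1)) :
    (∀ ℓ ∈ Finset.Ico 1 n,
      IntervalIntegrable
        (fun t : ℝ =>
          ((|∏ k ∈ Finset.Icc 1 n, (a k - t)| ^ (1 / (n : ℝ)) : ℝ) : ℂ) / ((t : ℂ) + z))
        MeasureTheory.volume (a ℓ) (a (ℓ + 1))) ∧
    geomMeanPrincipal n (fun k => (a k : ℂ) + z) =
      (arithMean n a : ℂ) + z
        - (1 / (Real.pi : ℂ)) *
          ∑ ℓ ∈ Finset.Ico 1 n,
            ((Real.sin ((ℓ : ℝ) * Real.pi / (n : ℝ)) : ℝ) : ℂ) *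
              ∫ t in (a ℓ)..(a (ℓ + 1)),
                ((|∏ k ∈ Finset.Icc 1 n, (a k - t)| ^ (1 / (n : ℝ)) : ℝ) : ℂ) /
                  ((t : ℂ) + z) := by
  have ha : ∀ i j, 1 ≤ i → i ≤ j → j ≤ n → a i ≤ a j := by
    intro i j hi hij
    induction j, hij using Nat.le_induction with
    | base => exact fun _ => le_rfl
    | succ j hij ih => exact fun hj => (ih (by omega)).trans (ha_mono j (hi.trans hij) hj)
  refine ⟨fun ℓ hℓ => ?_, geomMeanPrincipal_eq_geomMeanIntegral hn ha_pos ha hz⟩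
  rw [Finset.mem_Ico] at hℓ
  refine intervalIntegrable_rpow_div_add (P := fun t => ∏ k ∈ Finset.Icc 1 n, (a k - t))
    (by fun_prop) (by positivity) fun t ht h => hz ⟨-t, ?_, ?_⟩
  · rw [Set.uIcc_of_le (ha _ _ hℓ.1 (Nat.le_succ _) hℓ.2)] at ht
    exact neg_le_neg ((ha 1 ℓ le_rfl hℓ.1 hℓ.2.le).trans ht.1)
  · rw [Complex.ofReal_neg]
    exact neg_eq_of_add_eq_zero_right h
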